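/- Let $n\ge 1$ and $k\ge 2$ be integers with $k\mid n$. Let $\mathbb S^n$ be the space of real symmetric $n\times n$ matrices with $\langle X,Y\rangle=\mathrm{tr}(XY)$, let $\mathbb S^{(n,k)}=\prod_{J\subseteq[n],|J|=k}\mathbb S^k$ with inner product $\sum_J\langle X_J,Y_J\rangle$, and let $\Psi:\mathbb S^{(n,k)}\to\mathbb S^n$, $\Psi(\mathcal Y)=\sum_{|J|=k}Y_J^{\to n}$, where $Y_J^{\to n}$ is the $n\times n$ matrix that has $Y_J$ as its principal submatrix indexed by $J$ and zeros elsewhere. Put $\mathcal Y_0=\big(\binom{n-1}{k-1}^{-1}I_k\big)_{J}$ and $f^{\mathrm{FW}(k)}(\mathcal Y)=-\sum_{|J|=k}\log\det Y_J$ (for positive definite blocks). For a function $f$ with gradient $g(x)$ and positive definite Hessian $H(x)$ at a point $x$ of an affine subspace $L$, the Newton decrement of the restriction $f_{|L}$ at $x$ is $\Delta(f_{|L},x)=\|P_{L,x}H(x)^{-1}g(x)\|_x$, where $\langle u,w\rangle_x=\langle u,H(x)w\rangle$, $\|\cdot\|_x$ is the corresponding norm, and $P_{L,x}$ is the $\langle\cdot,\cdot\rangle_x$-orthogonal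 projection onto the linear subspace parallel to $L$. Let $A_0,\dots,A_m\in\mathbb S^n$ and $b\in\mathbb R^m$, and let $X_\ell\succeq0$ satisfy $\langle A_i,X_\ell\rangle=b_i$ for $i=1,\dots,m$; put $v=\langle A_0,X_\ell\rangle$ and $A_i^{(\ell)}=X_\ell^{1/2}A_iX_\ell^{1/2}$ for $i=0,\dots,m$. Define $$L_\ell=\{X\in\mathbb S^n:\langle A_i^{(\ell)},X\rangle=b_i,\ i=1,\dots,m\},$$ $$L^\Psi_\ell(v)=\{\mathcal Y\in\mathbb S^{(n,k)}:\langle A_0^{(\ell)},\Psi(\mathcal Y)\rangle=v,\ \langle A_i^{(\ell)},\Psi(\mathcal Y)\rangle=b_i,\ i=1,\dots,m\},$$ and, for $\eta\in\mathbb R$ and $X\succ0$, $f^{\mathrm{SDP}}_{\eta}(X)=\eta\langle A_0^{(\ell)},X\rangle-\log\det X$. Suppose that $$\Delta\big(f^{\mathrm{FW}(k)}_{|L^\Psi_\ell(v)},\mathcal Y_0\big)\le\tfrac1{14}.$$ Then there is a real number $\eta_v$ such that $f^{\mathrm{SDP}}_{\eta_v}$ has a minimizer over $\{X\in L_\ell:X\succ0\}$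 whose objective value $\langle A_0^{(\ell)},X\rangle$ equals $v$, and every such $\eta_v$ satisfies $$\Delta\big((f^{\mathrm{SDP}}_{\eta_v})_{|L_\ell},I\big)\le\tfrac19.$$ -/

import Mathlib

open scoped InnerProductSpace

noncomputable section

namespace FactorWidth

/-! ### Symmetric matrices with the trace inner product -/

/-- The real symmetric matrices, as a linear subspace of all square matrices. -/
def symSubmodule (ι : Type) [Fintype ι] : Submodule ℝ (Matrix ι ι ℝ) where
  carrier := {X | X.IsSymm}
  add_mem' hX hY := hX.add hY
  zero_mem' := Matrix.isSymm_zero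
  smul_mem' c _ hX := hX.smul c

/-- The space of real symmetric matrices indexed by `ι`. It is a type of its own, so that its
norm is the one that comes from the trace inner product. -/
def SymMat (ι : Type) [Fintype ι] : Type := symSubmodule ι

namespace SymMat

variable {ι : Type} [Fintype ι]

instance : AddCommGroup (SymMat ι) := inferInstanceAs (AddCommGroup (symSubmodule ι))

instance : Module ℝ (SymMat ι) := inferInstanceAs (Module ℝ (symSubmodule ι))

instance : FiniteDimensional ℝ (SymMat ι) :=
  inferInstanceAs (FiniteDimensional ℝ (symSubmodule ι))

/-- The underlying matrix, as a linear map. -/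
def mat : SymMat ι →ₗ[ℝ] Matrix ι ι ℝ := (symSubmodule ι).subtype

/-- A symmetric matrix as an element of `SymMat ι`. -/
def mk (X : Matrix ι ι ℝ) (hX : X.IsSymm) : SymMat ι := (⟨X, hX⟩ : symSubmodule ι)

@[simp]
theorem mat_mk (X : Matrix ι ι ℝ) (hX : X.IsSymm) : (mk X hX).mat = X := rfl

theorem isSymm (X : SymMat ι) : X.mat.IsSymm := X.2

theorem mat_injective : Function.Injective (mat : SymMat ι → Matrix ι ι ℝ) :=
  Subtype.val_injective

/-- The trace inner product `⟨X, Y⟩ = tr (X Y)`. -/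
abbrev core : InnerProductSpace.Core ℝ (SymMat ι) where
  inner X Y := (X.mat * Y.mat).trace
  conj_inner_symm X Y := by
    simpa using Matrix.trace_mul_comm Y.mat X.mat
  re_inner_nonneg X := by
    have h : (X.mat * X.mat).trace = ∑ i, ∑ j, X.mat i j ^ 2 := by
      simp only [Matrix.trace, Matrix.diag, Matrix.mul_apply]
      refine Finset.sum_congr rfl fun i _ => Finset.sum_congr rfl fun j _ => ?_
      rw [← X.isSymm.apply i j, pow_two]
    change 0 ≤ (X.mat * X.mat).trace
    rw [h]
    positivity
  add_left X Y Z := by simp [add_mul]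
  smul_left X Y r := by simp
  definite X hX := by
    have h : (X.mat * X.mat).trace = ∑ i, ∑ j, X.mat i j ^ 2 := by
      simp only [Matrix.trace, Matrix.diag, Matrix.mul_apply]
      refine Finset.sum_congr rfl fun i _ => Finset.sum_congr rfl fun j _ => ?_
      rw [← X.isSymm.apply i j, pow_two]
    have h0 : ∑ i, ∑ j, X.mat i j ^ 2 = 0 := h.symm.trans hX
    apply mat_injective
    ext i j
    have h1 := (Finset.sum_eq_zero_iff_of_nonneg
      (fun i _ => Finset.sum_nonneg fun j _ => sq_nonneg (X.mat i j))).1 h0 i (Finset.mem_univ i)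
    have h2 := (Finset.sum_eq_zero_iff_of_nonneg
      (fun j _ => sq_nonneg (X.mat i j))).1 h1 j (Finset.mem_univ j)
    simpa using h2

instance : NormedAddCommGroup (SymMat ι) := (core (ι := ι)).toNormedAddCommGroup

instance : InnerProductSpace ℝ (SymMat ι) := InnerProductSpace.ofCore core.toCore

instance : CompleteSpace (SymMat ι) := FiniteDimensional.complete ℝ _

theorem inner_def (X Y : SymMat ι) : ⟪X, Y⟫_ℝ = (X.mat * Y.mat).trace := rfl

/-- The identity matrix. -/
def id [DecidableEq ι] : SymMat ι := mk 1 Matrix.isSymm_one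

end SymMat

/-! ### Newton decrements -/

section Newton

variable {E : Type} [NormedAddCommGroup E] [InnerProductSpace ℝ E] [CompleteSpace E]

/-- The Hessian `H(x)` of `f`: the derivative of the gradient. -/
def hessian (f : E → ℝ) (x : E) : E →L[ℝ] E := fderiv ℝ (gradient f) x

/-- The local inner product `⟨u, w⟩_x = ⟨u, H(x) w⟩`. -/
def localInner (f : E → ℝ) (x u w : E) : ℝ := ⟪u, hessian f x w⟫_ℝ

/-- The local norm `‖u‖_x`. -/
def localNorm (f : E → ℝ) (x u : E) : ℝ := √(localInner f x u u)

/-- The projection `P_{V,x} w` of `w` onto the linear subspace `V`, orthogonal for the local inner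
product at `x`: the point `p` of `V` with `⟨u, w - p⟩_x = 0` for all `u` in `V`. (There is exactly
one such point when `H(x)` is positive definite and `E` is finite-dimensional.) -/
def localProj (f : E → ℝ) (x : E) (V : Submodule ℝ E) (w : E) : E :=
  Classical.epsilon fun p => p ∈ V ∧ ∀ u ∈ V, localInner f x u (w - p) = 0

/-- The Newton decrement `Δ(f|_L, x) = ‖P_{L,x} H(x)⁻¹ g(x)‖_x` of the restriction of `f` to the
translated linear subspace `L`; the projection is onto the linear subspace parallel to `L`. -/
def newtonDecrement (f : E → ℝ) (L : AffineSubspace ℝ E) (x : E) : ℝ :=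
  localNorm f x (localProj f x L.direction ((hessian f x).inverse (gradient f x)))

end Newton

/-! ### The affine solution set of a linear system -/

/-- The solution set `{x | T x = c}` of a linear system. -/
def solutionSet {E F : Type} [AddCommGroup E] [Module ℝ E] [AddCommGroup F] [Module ℝ F]
    (T : E →ₗ[ℝ] F) (c : F) : AffineSubspace ℝ E where
  carrier := {x | T x = c}
  smul_vsub_vadd_mem' r p q s hp hq hs := by
    change T _ = c at hp hq hs ⊢
    simp [hp, hq, hs]

/-! ### Products of small symmetric matrices -/

/-- The index sets `J ⊆ [n]` with `|J| = k`. -/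
abbrev Blocks (n k : ℕ) : Type := {J : Finset (Fin n) // J.card = k}

/-- The space `𝕊^(n,k)` of families `(Y_J)` of symmetric `k × k` matrices, with the inner product
`∑ J, ⟨X_J, Y_J⟩`. -/
abbrev SymBlocks (n k : ℕ) : Type := PiLp 2 fun _ : Blocks n k => SymMat (Fin k)

/-- For `J = {i_1 < ⋯ < i_k}` and a `k × k` matrix `S`, the `n × n` matrix with entry `S a b` at
`(i_a, i_b)`, and zeros elsewhere. -/
def expand {n k : ℕ} (J : Blocks n k) (S : Matrix (Fin k) (Fin k) ℝ) :
    Matrix (Fin n) (Fin n) ℝ :=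
  Matrix.of fun i j =>
    if h : i ∈ J.1 ∧ j ∈ J.1 then
      S ((J.1.orderIsoOfFin J.2).symm ⟨i, h.1⟩) ((J.1.orderIsoOfFin J.2).symm ⟨j, h.2⟩)
    else 0

theorem expand_isSymm {n k : ℕ} (J : Blocks n k) {S : Matrix (Fin k) (Fin k) ℝ}
    (hS : S.IsSymm) : (expand J S).IsSymm := by
  ext i j
  simp only [expand, Matrix.transpose_apply, Matrix.of_apply]
  by_cases h : i ∈ J.1 ∧ j ∈ J.1
  · rw [dif_pos h, dif_pos h.symm]
    exact hS.apply _ _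
  · rw [dif_neg h, dif_neg fun h' => h h'.symm]

/-- `expand` on symmetric matrices, as a linear map. -/
def expandSym {n k : ℕ} (J : Blocks n k) : SymMat (Fin k) →ₗ[ℝ] SymMat (Fin n) where
  toFun S := SymMat.mk (expand J S.mat) (expand_isSymm J S.isSymm)
  map_add' S T := by
    apply SymMat.mat_injective
    ext i j
    simp only [SymMat.mat_mk, map_add, Matrix.add_apply, expand, Matrix.of_apply]
    split_ifs <;> simp
  map_smul' c S := by
    apply SymMat.mat_injective
    ext i j
    simp only [SymMat.mat_mk, map_smul, Matrix.smul_apply, expand, Matrix.of_apply,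
      RingHom.id_apply]
    split_ifs <;> simp

/-- The operator `Ψ(𝒴) = ∑ J, (Y_J)^{→n}`. -/
def Psi (n k : ℕ) : SymBlocks n k →ₗ[ℝ] SymMat (Fin n) where
  toFun Y := ∑ J, expandSym J (Y J)
  map_add' Y Z := by simp [Finset.sum_add_distrib]
  map_smul' c Y := by simp [Finset.smul_sum]

/-- The point `𝒴₀`, all of whose blocks are the identity divided by `(n-1).choose (k-1)`. -/
def Y0 (n k : ℕ) : SymBlocks n k :=
  WithLp.toLp 2 fun _ => (((n - 1).choose (k - 1) : ℝ)⁻¹) • SymMat.id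

/-- The barrier `-∑ J, log det Y_J` of the product of the cones of positive semidefinite
`k × k` matrices (meaningful where all blocks are positive definite). -/
def fFW (n k : ℕ) (Y : SymBlocks n k) : ℝ := -∑ J, Real.log (Y J).mat.det

/-! ### The rescaled semidefinite program -/

section SDP

open scoped MatrixOrder

variable {n m : ℕ}

theorem sqrt_isSymm (X : Matrix (Fin n) (Fin n) ℝ) : (CFC.sqrt X).IsSymm := by
  have h := (Matrix.nonneg_iff_posSemidef.1 (CFC.sqrt_nonneg X)).isHermitian
  simpa only [Matrix.IsSymm, Matrix.IsHermitian, Matrix.conjTranspose_eq_transpose_of_trivial]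
    using h

/-- The rescaled matrix `X^{1/2} A X^{1/2}`. -/
def rescale (X A : SymMat (Fin n)) : SymMat (Fin n) :=
  SymMat.mk (CFC.sqrt X.mat * A.mat * CFC.sqrt X.mat) (by
    have h := sqrt_isSymm X.mat
    have hA := A.isSymm
    simp only [Matrix.IsSymm] at h hA ⊢
    simp [Matrix.transpose_mul, h, hA, Matrix.mul_assoc])

/-- The operator `X ↦ (⟨A_i, X⟩)_i` of a family of symmetric matrices. -/
def traceOp {ι : Type} (A : ι → SymMat (Fin n)) : SymMat (Fin n) →ₗ[ℝ] (ι → ℝ) :=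
  LinearMap.pi fun i => (innerₗ (SymMat (Fin n))) (A i)

/-- `L_ℓ`: the matrices `Z` with `⟨A_i^(ℓ), Z⟩ = b_i` for `i = 1, …, m`, where
`A_i^(ℓ) = X^{1/2} A_i X^{1/2}` and `X` is the current iterate. The objective `A_0` is the entry
`A 0` of the family `A`, and the constraint `A_i` is the entry `A i.succ`. -/
def Lell (A : Fin (m + 1) → SymMat (Fin n)) (b : Fin m → ℝ) (X : SymMat (Fin n)) :
    AffineSubspace ℝ (SymMat (Fin n)) :=
  solutionSet (traceOp fun i : Fin m => rescale X (A i.succ)) b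

/-- `L^Ψ_ℓ(v)`: the families `𝒴` with `⟨A_i^(ℓ), Ψ(𝒴)⟩ = b_i` for `i = 1, …, m` and
`⟨A_0^(ℓ), Ψ(𝒴)⟩ = v`. -/
def LPsi (k : ℕ) (A : Fin (m + 1) → SymMat (Fin n)) (b : Fin m → ℝ) (X : SymMat (Fin n))
    (v : ℝ) : AffineSubspace ℝ (SymBlocks n k) :=
  solutionSet (traceOp (fun i : Fin (m + 1) => rescale X (A i)) ∘ₗ Psi n k)
    (Fin.cons v b : Fin (m + 1) → ℝ)

/-- The functional `η ⟨A_0^(ℓ), Z⟩ - log det Z` (meaningful for positive definite `Z`). -/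
def fSDP (A0 X : SymMat (Fin n)) (η : ℝ) (Z : SymMat (Fin n)) : ℝ :=
  η * ⟪rescale X A0, Z⟫_ℝ - Real.log Z.mat.det

/-- `η` is a parameter `η_v`: over the positive definite matrices in `L_ℓ`, the functional
`η ⟨A_0^(ℓ), Z⟩ - log det Z` has a minimizer whose objective value `⟨A_0^(ℓ), Z⟩` is `v`. -/
def IsCentralParameter (A : Fin (m + 1) → SymMat (Fin n)) (b : Fin m → ℝ) (X : SymMat (Fin n))
    (v η : ℝ) : Prop :=
  ∃ Z : SymMat (Fin n), Z ∈ Lell A b X ∧ Z.mat.PosDef ∧ ⟪rescale X (A 0), Z⟫_ℝ = v ∧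
    ∀ W : SymMat (Fin n), W ∈ Lell A b X → W.mat.PosDef →
      fSDP (A 0) X η Z ≤ fSDP (A 0) X η W

end SDP

end FactorWidth

end

open FactorWidth

/-!
Everything is measured at the identity, where the Hessians of both barriers are multiples of the
identity; the Newton decrements there are norms of ordinary orthogonal projections of the gradient.

Dividing each entry of a symmetric matrix evenly among the blocks that contain its position gives a
right inverse of `Ψ` that does not increase the norm. Hence a bound `δ` on the factor-width
decrement yields `|tr U| ≤ δ ‖U‖` for all directions `U` of the slice of `L_ℓ` on which the
objective is `v`.

Let `Z` maximize `log det` on that slice, intersected with a ball around `I` of radius `ρ < 1`, and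
put `r = ‖Z - I‖`. Moving from `Z` towards `I` does not increase `log det`, so
`⟨Z⁻¹, Z - I⟩ ≥ 0`, and the eigenvalues of `Z` give
`r² / (1 + r) ≤ ⟨I - Z⁻¹, Z - I⟩ ≤ tr (Z - I) ≤ δ r`, that is `r ≤ δ / (1 - δ)`. If
`δ / (1 - δ) < ρ`, the maximizer is interior, hence critical, and the Lagrange multiplier of the
objective is `η_v`.

Conversely, every central parameter arises from such a critical point `Z`, and the gradient
`η A_0^(ℓ) - I` of `fSDP` at `I` has the same projection onto the direction of `L_ℓ` as
`Z⁻¹ - I`, whose norm is at most `r / (1 - r) ≤ δ / (1 - 2 δ)`.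
-/

noncomputable section

open scoped InnerProductSpace
open Filter Topology

namespace FactorWidth

section InnerProductSpace

variable {E : Type*} [NormedAddCommGroup E] [InnerProductSpace ℝ E]

theorem hasGradientAt_of_subgradient_inequalities [CompleteSpace E] {f : E → ℝ} {g : E → E}
    {x : E} (hg : ContinuousAt g x) (hle : ∀ᶠ y in 𝓝 x, f y ≤ f x + ⟪g x, y - x⟫_ℝ)
    (hge : ∀ᶠ y in 𝓝 x, f x ≤ f y + ⟪g y, x - y⟫_ℝ) : HasGradientAt f (g x) x := by
  rw [hasGradientAt_iff_isLittleO, Asymptotics.isLittleO_iff]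
  intro ε hε
  have hnear : ∀ᶠ y in 𝓝 x, ‖g y - g x‖ < ε :=
    (hg.sub continuousAt_const).norm.eventually_lt_const (by simpa using hε)
  filter_upwards [hle, hge, hnear] with y hy_le hy_ge hy_near
  have hinner : -(ε * ‖y - x‖) ≤ ⟪g y - g x, y - x⟫_ℝ := by
    refine le_trans ?_ (abs_le.1 (abs_real_inner_le_norm _ _)).1
    gcongr
  rw [← neg_sub y x, inner_neg_right] at hy_ge
  rw [inner_sub_left] at hinner
  have : 0 ≤ ε * ‖y - x‖ := by positivity
  rw [Real.norm_eq_abs, abs_le]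
  constructor <;> linarith

theorem inner_gradient_sub_nonneg_of_isMaxOn [CompleteSpace E] {f : E → ℝ} {g x y : E}
    {s : Set E} (hs : Convex ℝ s) (hf : HasGradientAt f g x) (hmax : IsMaxOn f s x)
    (hx : x ∈ s) (hy : y ∈ s) : 0 ≤ ⟪g, x - y⟫_ℝ := by
  have h := hmax.localize.hasFDerivWithinAt_nonpos hf.hasFDerivAt.hasFDerivWithinAt
    (sub_mem_posTangentConeAt_of_segment_subset (hs.segment_subset hx hy))
  rw [InnerProductSpace.toDual_apply_apply, ← neg_sub x y, inner_neg_right] at h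
  linarith

theorem gradient_mem_orthogonal_of_isLocalExtrOn [CompleteSpace E] {f : E → ℝ} {g x : E}
    {L : AffineSubspace ℝ E} (hf : HasGradientAt f g x) (hextr : IsLocalExtrOn f L x)
    (hx : x ∈ L) : g ∈ L.directionᗮ := by
  have hcone : ∀ u ∈ L.direction, u ∈ posTangentConeAt (L : Set E) x := fun u hu => by
    refine mem_posTangentConeAt_of_segment_subset (L.convex.segment_subset hx ?_)
    rw [add_comm]
    exact AffineSubspace.vadd_mem_of_mem_direction hu hx
  have hderiv := hf.hasFDerivAt.hasFDerivWithinAt (s := (L : Set E))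
  rw [Submodule.mem_orthogonal']
  intro u hu
  rcases hextr with hmin | hmax
  · exact IsLocalMinOn.hasFDerivWithinAt_eq_zero hmin hderiv (hcone u hu)
      (hcone (-u) (neg_mem hu))
  · exact IsLocalMaxOn.hasFDerivWithinAt_eq_zero hmax hderiv (hcone u hu)
      (hcone (-u) (neg_mem hu))

theorem abs_inner_le_norm_starProjection_mul_norm {V : Submodule ℝ E} [V.HasOrthogonalProjection]
    {u : E} (hu : u ∈ V) (w : E) : |⟪u, w⟫_ℝ| ≤ ‖V.starProjection w‖ * ‖u‖ := by
  calc |⟪u, w⟫_ℝ| = |⟪u, V.starProjection w⟫_ℝ| := by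
        rw [← V.inner_starProjection_left_eq_right, V.starProjection_eq_self_iff.2 hu]
    _ ≤ ‖V.starProjection w‖ * ‖u‖ := by
        rw [mul_comm]
        exact abs_real_inner_le_norm u _

theorem exists_smul_sub_mem_orthogonal [FiniteDimensional ℝ E] {V : Submodule ℝ E} {a w : E}
    (hw : w ∈ (V ⊓ (ℝ ∙ a)ᗮ)ᗮ) : ∃ η : ℝ, η • a - w ∈ Vᗮ := by
  have hsum : w ∈ Vᗮ ⊔ ℝ ∙ a := by
    rwa [← (Vᗮ ⊔ ℝ ∙ a).orthogonal_orthogonal, ← Submodule.inf_orthogonal,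
      V.orthogonal_orthogonal]
  obtain ⟨p, hp, q, hq, rfl⟩ := Submodule.mem_sup.1 hsum
  obtain ⟨η, rfl⟩ := Submodule.mem_span_singleton.1 hq
  exact ⟨η, by simpa using hp⟩

end InnerProductSpace

section Newton

variable {E : Type} [NormedAddCommGroup E] [InnerProductSpace ℝ E] [CompleteSpace E]

theorem localProj_eq_starProjection {f : E → ℝ} {x : E} {c : ℝ} (hc : c ≠ 0)
    (hf : hessian f x = c • ContinuousLinearMap.id ℝ E) (V : Submodule ℝ E)
    [V.HasOrthogonalProjection] (w : E) : localProj f x V w = V.starProjection w := by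
  have hinner (u z : E) : localInner f x u z = c * ⟪u, z⟫_ℝ := by
    simp [localInner, hf, inner_smul_right]
  have hex : ∃ p, p ∈ V ∧ ∀ u ∈ V, localInner f x u (w - p) = 0 := by
    refine ⟨V.starProjection w, V.starProjection_apply_mem w, fun u hu => ?_⟩
    rw [hinner, Submodule.inner_right_of_mem_orthogonal hu
      (V.sub_starProjection_mem_orthogonal w), mul_zero]
  obtain ⟨hmem, horth⟩ := Classical.epsilon_spec hex
  refine (Submodule.eq_starProjection_of_mem_of_inner_eq_zero hmem fun u hu => ?_).symm
  rw [real_inner_comm]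
  exact (mul_eq_zero.1 ((hinner u _).symm.trans (horth u hu))).resolve_left hc

theorem newtonDecrement_nonneg (f : E → ℝ) (L : AffineSubspace ℝ E) (x : E) :
    0 ≤ newtonDecrement f L x :=
  Real.sqrt_nonneg _

theorem newtonDecrement_eq_of_hasFDerivAt_gradient {f : E → ℝ} {x : E} {c : ℝ}
    (hc : 0 < c) (hf : HasFDerivAt (gradient f) (c • ContinuousLinearMap.id ℝ E) x)
    (L : AffineSubspace ℝ E) [L.direction.HasOrthogonalProjection] :
    newtonDecrement f L x = (√c)⁻¹ * ‖L.direction.starProjection (gradient f x)‖ := by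
  have hH : hessian f x = c • ContinuousLinearMap.id ℝ E := hf.fderiv
  have hinv : (hessian f x).inverse = c⁻¹ • ContinuousLinearMap.id ℝ E := by
    rw [hH]
    refine ContinuousLinearMap.inverse_eq ?_ ?_ <;> ext u <;> simp [smul_smul, hc.ne']
  rw [newtonDecrement, localProj_eq_starProjection hc.ne' hH, hinv]
  set p := L.direction.starProjection (gradient f x)
  have hp : L.direction.starProjection ((c⁻¹ • ContinuousLinearMap.id ℝ E) (gradient f x)) =
      c⁻¹ • p := by
    simp [p]
  have hsq : ⟪c⁻¹ • p, c • c⁻¹ • p⟫_ℝ = c⁻¹ * ‖p‖ ^ 2 := by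
    rw [smul_inv_smul₀ hc.ne', real_inner_smul_left, real_inner_self_eq_norm_sq]
  rw [hp, localNorm, localInner, hH, smul_apply,
    ContinuousLinearMap.id_apply, hsq, Real.sqrt_mul (inv_nonneg.2 hc.le), Real.sqrt_inv,
    Real.sqrt_sq (norm_nonneg p)]

end Newton

section SolutionSet

variable {E F : Type} [AddCommGroup E] [Module ℝ E] [AddCommGroup F] [Module ℝ F]
  {T : E →ₗ[ℝ] F} {c : F} {x : E}

theorem mem_solutionSet : x ∈ solutionSet T c ↔ T x = c :=
  Iff.rfl

theorem direction_solutionSet (hx : x ∈ solutionSet T c) :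
    (solutionSet T c).direction = LinearMap.ker T := by
  ext u
  rw [← AffineSubspace.vadd_mem_iff_mem_direction u hx, LinearMap.mem_ker, mem_solutionSet,
    vadd_eq_add, map_add, mem_solutionSet.1 hx, add_eq_right]

end SolutionSet

namespace SymMat

variable {ι : Type} [Fintype ι]

theorem isHermitian (X : SymMat ι) : X.mat.IsHermitian :=
  X.isSymm

theorem norm_sq_eq_sum (X : SymMat ι) : ‖X‖ ^ 2 = ∑ i, ∑ j, X.mat i j ^ 2 := by
  rw [← real_inner_self_eq_norm_sq, inner_def]
  simp only [Matrix.trace, Matrix.diag, Matrix.mul_apply]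
  refine Finset.sum_congr rfl fun i _ => Finset.sum_congr rfl fun j _ => ?_
  rw [← X.isSymm.apply i j, pow_two]

/-- The congruence transformation `X ↦ Sᵀ X S`. It moves a positive definite matrix to the
identity without leaving the symmetric matrices. -/
def congruence (S : Matrix ι ι ℝ) : SymMat ι →ₗ[ℝ] SymMat ι where
  toFun X := mk (S.transpose * X.mat * S) (by
    have hX := X.isSymm
    simp only [Matrix.IsSymm] at hX ⊢
    simp [Matrix.transpose_mul, hX, Matrix.mul_assoc])
  map_add' X Y := mat_injective (by simp [Matrix.mul_add, Matrix.add_mul])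
  map_smul' c X := mat_injective (by simp)

theorem mat_congruence (S : Matrix ι ι ℝ) (X : SymMat ι) :
    (congruence S X).mat = S.transpose * X.mat * S :=
  rfl

variable [DecidableEq ι]

@[simp]
theorem mat_id : (id : SymMat ι).mat = 1 :=
  rfl

theorem inner_id (X : SymMat ι) : ⟪X, id⟫_ℝ = X.mat.trace := by
  rw [inner_def, mat_id, mul_one]

theorem posDef_smul_id {a : ℝ} (ha : 0 < a) : (a • (id : SymMat ι)).mat.PosDef := by
  rw [map_smul, mat_id]
  exact Matrix.PosDef.one.smul ha

/-- The inverse matrix; the zero matrix where `X` is singular. -/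
def inv (X : SymMat ι) : SymMat ι :=
  mk X.mat⁻¹ (by
    have hX : X.mat.transpose = X.mat := X.isSymm
    simp [Matrix.IsSymm, Matrix.transpose_nonsing_inv, hX])

@[simp]
theorem mat_inv (X : SymMat ι) : X.inv.mat = X.mat⁻¹ :=
  rfl

theorem inv_smul_id {a : ℝ} (ha : a ≠ 0) : (a • (id : SymMat ι)).inv = a⁻¹ • id := by
  refine mat_injective (Matrix.inv_eq_right_inv ?_)
  simp [smul_smul, ha]

theorem inv_id : (id : SymMat ι).inv = id := by
  simpa using inv_smul_id (ι := ι) one_ne_zero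

/-- The functional calculus `f(X)`: the matrix with the eigenvectors of `X` and the eigenvalues
`f(l)`, where `l` runs through the eigenvalues of `X`. -/
def functionalCalculus (f : ℝ → ℝ) (X : SymMat ι) : SymMat ι :=
  mk (cfc f X.mat) (cfc_predicate f X.mat)

theorem mat_functionalCalculus (f : ℝ → ℝ) (X : SymMat ι) :
    (functionalCalculus f X).mat = cfc f X.mat :=
  rfl

theorem continuousOn_spectrum (f : ℝ → ℝ) (X : SymMat ι) : ContinuousOn f (spectrum ℝ X.mat) :=
  X.mat.finite_real_spectrum.continuousOn f

theorem trace_functionalCalculus (f : ℝ → ℝ) (X : SymMat ι) :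
    (functionalCalculus f X).mat.trace = ∑ i, f (X.isHermitian.eigenvalues i) := by
  rw [mat_functionalCalculus, X.isHermitian.cfc_eq, Matrix.IsHermitian.cfc,
    Unitary.conjStarAlgAut_apply, Matrix.trace_mul_comm, ← mul_assoc, Unitary.coe_star_mul_self,
    one_mul, Matrix.trace_diagonal]
  rfl

theorem inner_functionalCalculus (f g : ℝ → ℝ) (X : SymMat ι) :
    ⟪functionalCalculus f X, functionalCalculus g X⟫_ℝ =
      ∑ i, f (X.isHermitian.eigenvalues i) * g (X.isHermitian.eigenvalues i) := by
  rw [← trace_functionalCalculus (fun x => f x * g x), inner_def]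
  congr 1
  exact (cfc_mul f g X.mat (X.continuousOn_spectrum f) (X.continuousOn_spectrum g)).symm

theorem sub_id_eq_functionalCalculus (X : SymMat ι) :
    X - id = functionalCalculus (fun x => x - 1) X := by
  apply mat_injective
  have hX : IsSelfAdjoint X.mat := X.isHermitian
  rw [mat_functionalCalculus, cfc_sub (fun x => x) (fun _ => 1) X.mat, cfc_id' ℝ X.mat,
    cfc_const_one ℝ X.mat, map_sub, mat_id]

theorem id_sub_inv_eq_functionalCalculus {X : SymMat ι} (hX : IsUnit X.mat) :
    id - X.inv = functionalCalculus (fun x => 1 - x⁻¹) X := by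
  apply mat_injective
  have hX' : IsSelfAdjoint X.mat := X.isHermitian
  rw [mat_functionalCalculus, cfc_sub (fun _ => 1) (fun x => x⁻¹) X.mat continuousOn_const
    (X.continuousOn_spectrum _), cfc_ringInverse_id X.mat hX, cfc_const_one ℝ X.mat, map_sub,
    mat_id, mat_inv, Matrix.nonsing_inv_eq_ringInverse]

theorem norm_sub_id_sq (X : SymMat ι) :
    ‖X - id‖ ^ 2 = ∑ i, (X.isHermitian.eigenvalues i - 1) ^ 2 := by
  rw [← real_inner_self_eq_norm_sq, sub_id_eq_functionalCalculus, inner_functionalCalculus]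
  simp only [pow_two]

theorem norm_inv_sub_id_sq {X : SymMat ι} (hX : IsUnit X.mat) :
    ‖X.inv - id‖ ^ 2 = ∑ i, (1 - (X.isHermitian.eigenvalues i)⁻¹) ^ 2 := by
  rw [norm_sub_rev, ← real_inner_self_eq_norm_sq, id_sub_inv_eq_functionalCalculus hX,
    inner_functionalCalculus]
  simp only [pow_two]

theorem inner_id_sub_inv_sub_id {X : SymMat ι} (hX : X.mat.PosDef) :
    ⟪id - X.inv, X - id⟫_ℝ =
      ∑ i, (X.isHermitian.eigenvalues i - 1) ^ 2 / X.isHermitian.eigenvalues i := by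
  rw [id_sub_inv_eq_functionalCalculus hX.isUnit, sub_id_eq_functionalCalculus,
    inner_functionalCalculus]
  refine Finset.sum_congr rfl fun i _ => ?_
  have := (hX.eigenvalues_pos i).ne'
  field_simp

theorem abs_eigenvalues_sub_one_le (X : SymMat ι) (i : ι) :
    |X.isHermitian.eigenvalues i - 1| ≤ ‖X - id‖ := by
  refine abs_le_of_sq_le_sq ?_ (norm_nonneg _)
  rw [norm_sub_id_sq]
  exact Finset.single_le_sum (f := fun i => (X.isHermitian.eigenvalues i - 1) ^ 2)
    (fun j _ => sq_nonneg _) (Finset.mem_univ i)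

theorem posDef_of_norm_sub_id_lt_one {X : SymMat ι} (h : ‖X - id‖ < 1) : X.mat.PosDef := by
  refine X.isHermitian.posDef_iff_eigenvalues_pos.2 fun i => ?_
  linarith [(abs_le.1 (X.abs_eigenvalues_sub_one_le i)).1]

theorem norm_sub_id_sq_div_le_inner {X : SymMat ι} (hX : X.mat.PosDef) :
    ‖X - id‖ ^ 2 / (1 + ‖X - id‖) ≤ ⟪id - X.inv, X - id⟫_ℝ := by
  rw [inner_id_sub_inv_sub_id hX, norm_sub_id_sq, Finset.sum_div]
  refine Finset.sum_le_sum fun i _ => ?_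
  exact div_le_div_of_nonneg_left (sq_nonneg _) (hX.eigenvalues_pos i)
    (by linarith [(abs_le.1 (X.abs_eigenvalues_sub_one_le i)).2])

theorem norm_sub_id_le {Z : SymMat ι} {δ : ℝ} (hδ : 0 ≤ δ) (hδ1 : δ < 1) (hZ : Z.mat.PosDef)
    (hinv : 0 ≤ ⟪Z.inv, Z - id⟫_ℝ) (htrace : ⟪Z - id, id⟫_ℝ ≤ δ * ‖Z - id‖) :
    ‖Z - id‖ ≤ δ / (1 - δ) := by
  set r := ‖Z - id‖
  have hr : 0 ≤ r := norm_nonneg _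
  have hupper : r ^ 2 / (1 + r) ≤ δ * r := by
    refine (norm_sub_id_sq_div_le_inner hZ).trans ?_
    rw [inner_sub_left, real_inner_comm]
    linarith
  rw [div_le_iff₀ (by linarith)] at hupper
  rw [le_div_iff₀ (by linarith)]
  rcases hr.eq_or_lt with hr0 | hr0
  · simpa [← hr0] using hδ
  · nlinarith

theorem norm_inv_sub_id_le {Z : SymMat ι} (hZ : ‖Z - id‖ < 1) :
    ‖Z.inv - id‖ ≤ ‖Z - id‖ / (1 - ‖Z - id‖) := by
  have hpos : Z.mat.PosDef := posDef_of_norm_sub_id_lt_one hZ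
  have : 0 < 1 - ‖Z - id‖ := by linarith
  refine (sq_le_sq₀ (norm_nonneg _) (by positivity)).1 ?_
  rw [norm_inv_sub_id_sq hpos.isUnit, div_pow, norm_sub_id_sq, Finset.sum_div]
  refine Finset.sum_le_sum fun i _ => ?_
  have hle := (abs_le.1 (Z.abs_eigenvalues_sub_one_le i)).1
  set l := Z.isHermitian.eigenvalues i
  have hl : 0 < l := hpos.eigenvalues_pos i
  calc (1 - l⁻¹) ^ 2 = (l - 1) ^ 2 / l ^ 2 := by field_simp
    _ ≤ (l - 1) ^ 2 / (1 - ‖Z - id‖) ^ 2 := by gcongr; linarith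

open scoped MatrixOrder Matrix.Norms.L2Operator in
theorem exists_congruence_eq_id {Z : SymMat ι} (hZ : Z.mat.PosDef) :
    ∃ S : Matrix ι ι ℝ, IsUnit S ∧ congruence S Z = id := by
  obtain ⟨B, hB, hBZ⟩ :=
    CStarAlgebra.isStrictlyPositive_iff_eq_star_mul_self.1 hZ.isStrictlyPositive
  have hdet : IsUnit B.det := (Matrix.isUnit_iff_isUnit_det B).1 hB
  have hdetT : IsUnit B.transpose.det := by rwa [Matrix.det_transpose]
  refine ⟨B⁻¹, Matrix.isUnit_nonsing_inv_iff.2 hB, mat_injective ?_⟩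
  rw [mat_congruence, hBZ, Matrix.star_eq_conjTranspose,
    Matrix.conjTranspose_eq_transpose_of_trivial, mat_id, Matrix.transpose_nonsing_inv,
    mul_assoc, mul_assoc, Matrix.mul_nonsing_inv _ hdet, mul_one, Matrix.nonsing_inv_mul _ hdetT]

theorem inv_eq_mul_transpose_of_congruence_eq_id {S : Matrix ι ι ℝ} {Z : SymMat ι}
    (h : congruence S Z = id) : Z.mat⁻¹ = S * S.transpose := by
  have hone : S.transpose * (Z.mat * S) = 1 := by
    rw [← mul_assoc, ← mat_congruence, h, mat_id]
  refine Matrix.inv_eq_right_inv ?_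
  rw [← mul_assoc, mul_eq_one_comm.1 hone]

theorem posDef_congruence_iff {S : Matrix ι ι ℝ} (hS : IsUnit S) (X : SymMat ι) :
    (congruence S X).mat.PosDef ↔ X.mat.PosDef := by
  rw [mat_congruence, ← Matrix.conjTranspose_eq_transpose_of_trivial]
  exact Matrix.IsUnit.posDef_star_left_conjugate_iff hS

theorem eventually_posDef {κ : Type} [Fintype κ] {Z : SymMat κ} (hZ : Z.mat.PosDef) :
    ∀ᶠ W in 𝓝 Z, W.mat.PosDef := by
  classical
  obtain ⟨S, hS, hSZ⟩ := exists_congruence_eq_id hZ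
  have hcont : Continuous fun W => ‖congruence S W - id‖ :=
    ((LinearMap.continuous_of_finiteDimensional _).sub continuous_const).norm
  have hzero : ‖congruence S Z - id‖ < 1 := by simp [hSZ]
  filter_upwards [hcont.continuousAt.eventually_lt_const hzero] with W hW
  exact (posDef_congruence_iff hS W).1 (posDef_of_norm_sub_id_lt_one hW)

theorem log_det_le_trace_sub_card {X : SymMat ι} (hX : X.mat.PosDef) :
    Real.log X.mat.det ≤ X.mat.trace - Fintype.card ι := by
  rw [hX.isHermitian.det_eq_prod_eigenvalues, hX.isHermitian.trace_eq_sum_eigenvalues]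
  simp only [RCLike.ofReal_real_eq_id, id_eq]
  calc Real.log (∏ i, hX.isHermitian.eigenvalues i)
      = ∑ i, Real.log (hX.isHermitian.eigenvalues i) :=
        Real.log_prod fun i _ => (hX.eigenvalues_pos i).ne'
    _ ≤ ∑ i, (hX.isHermitian.eigenvalues i - 1) :=
        Finset.sum_le_sum fun i _ => Real.log_le_sub_one_of_pos (hX.eigenvalues_pos i)
    _ = ∑ i, hX.isHermitian.eigenvalues i - Fintype.card ι := by simp

theorem inner_inv_self {Z : SymMat ι} (hZ : IsUnit Z.mat.det) :
    ⟪Z.inv, Z⟫_ℝ = Fintype.card ι := by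
  rw [inner_def, mat_inv, Matrix.nonsing_inv_mul _ hZ, Matrix.trace_one]

theorem log_det_le_add_inner {W Z : SymMat ι} (hW : W.mat.PosDef) (hZ : Z.mat.PosDef) :
    Real.log W.mat.det ≤ Real.log Z.mat.det + ⟪Z.inv, W - Z⟫_ℝ := by
  obtain ⟨S, hS, hSZ⟩ := exists_congruence_eq_id hZ
  have hinv := inv_eq_mul_transpose_of_congruence_eq_id hSZ
  have htrace : (congruence S W).mat.trace = ⟪Z.inv, W⟫_ℝ := by
    rw [mat_congruence, inner_def, mat_inv, hinv, Matrix.trace_mul_comm, mul_assoc]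
  have hdet : (congruence S W).mat.det = W.mat.det / Z.mat.det := by
    have hSdet : Z.mat.det⁻¹ = S.det * S.det := by
      rw [← Ring.inverse_eq_inv', ← Matrix.det_nonsing_inv, hinv, Matrix.det_mul,
        Matrix.det_transpose]
    rw [mat_congruence, Matrix.det_mul, Matrix.det_mul, Matrix.det_transpose, div_eq_mul_inv,
      hSdet]
    ring
  have h := log_det_le_trace_sub_card ((posDef_congruence_iff hS W).2 hW)
  rw [hdet, htrace, Real.log_div hW.det_pos.ne' hZ.det_pos.ne'] at h
  rw [inner_sub_right, inner_inv_self hZ.det_pos.ne'.isUnit]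
  linarith

open scoped Matrix.Norms.Operator in
theorem hasFDerivAt_inv {Z : SymMat ι} (hZ : IsUnit Z.mat) :
    HasFDerivAt (inv : SymMat ι → SymMat ι) (-(congruence Z.mat⁻¹).toContinuousLinearMap) Z := by
  obtain ⟨p, hp⟩ := LinearMap.exists_leftInverse_of_injective (mat : SymMat ι →ₗ[ℝ] _)
    (LinearMap.ker_eq_bot.2 mat_injective)
  have hp_mat (X : SymMat ι) : p X.mat = X := LinearMap.congr_fun hp X
  obtain ⟨u, hu⟩ := hZ
  have hinv := hasFDerivAt_ringInverse (𝕜 := ℝ) u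
  rw [hu] at hinv
  have hmat : HasFDerivAt (fun X : SymMat ι => X.mat) mat.toContinuousLinearMap Z :=
    mat.toContinuousLinearMap.hasFDerivAt
  have hcomp := p.toContinuousLinearMap.hasFDerivAt.comp Z (hinv.comp Z hmat)
  refine (hcomp.congr_fderiv ?_).congr_of_eventuallyEq (Eventually.of_forall fun X => ?_)
  · ext1 U
    have hU : (congruence Z.mat⁻¹ U).mat = Z.mat⁻¹ * U.mat * Z.mat⁻¹ := by
      rw [mat_congruence, show (Z.mat⁻¹).transpose = Z.mat⁻¹ from Z.inv.isSymm]
    change p (-((↑u⁻¹ : Matrix ι ι ℝ) * U.mat * (↑u⁻¹ : Matrix ι ι ℝ))) = -congruence Z.mat⁻¹ U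
    rw [Matrix.coe_units_inv, hu, ← hU, map_neg, hp_mat]
  · change X.inv = p (Ring.inverse X.mat)
    rw [← Matrix.nonsing_inv_eq_ringInverse, ← mat_inv, hp_mat]

theorem hasFDerivAt_inv_smul_id {a : ℝ} (ha : a ≠ 0) :
    HasFDerivAt (inv : SymMat ι → SymMat ι)
      (-((a⁻¹ ^ 2) • ContinuousLinearMap.id ℝ (SymMat ι))) (a • id) := by
  have hunit : IsUnit (a • (id : SymMat ι)).mat := isUnit_one.smul (Units.mk0 a ha)
  refine (hasFDerivAt_inv hunit).congr_fderiv (congrArg _ ?_)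
  ext1 U
  apply mat_injective
  change (congruence (a • id : SymMat ι).mat⁻¹ U).mat = (a⁻¹ ^ 2 • U).mat
  rw [mat_congruence, ← mat_inv, inv_smul_id ha]
  simp [smul_smul, pow_two]

theorem hasGradientAt_log_det {Z : SymMat ι} (hZ : Z.mat.PosDef) :
    HasGradientAt (fun X : SymMat ι => Real.log X.mat.det) Z.inv Z := by
  refine hasGradientAt_of_subgradient_inequalities (hasFDerivAt_inv hZ.isUnit).continuousAt ?_ ?_
  · filter_upwards [eventually_posDef hZ] with W hW using log_det_le_add_inner hW hZ
  · filter_upwards [eventually_posDef hZ] with W hW using log_det_le_add_inner hZ hW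

theorem exists_isMaxOn_log_det {L : AffineSubspace ℝ (SymMat ι)} (hL : id ∈ L) {ρ : ℝ}
    (hρ : 0 ≤ ρ) (hρ1 : ρ < 1) :
    ∃ Z ∈ (L : Set (SymMat ι)) ∩ Metric.closedBall id ρ, Z.mat.PosDef ∧
      IsMaxOn (fun W => Real.log W.mat.det) (L ∩ Metric.closedBall id ρ) Z := by
  have hpos : ∀ W ∈ (L : Set (SymMat ι)) ∩ Metric.closedBall id ρ, W.mat.PosDef := fun W hW =>
    posDef_of_norm_sub_id_lt_one ((mem_closedBall_iff_norm.1 hW.2).trans_lt hρ1)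
  have hcompact : IsCompact ((L : Set (SymMat ι)) ∩ Metric.closedBall id ρ) :=
    (isCompact_closedBall _ _).inter_left L.closed_of_finiteDimensional
  obtain ⟨Z, hZ, hmax⟩ := hcompact.exists_isMaxOn ⟨id, hL, Metric.mem_closedBall_self hρ⟩
    fun W hW => (hasGradientAt_log_det (hpos W hW)).continuousAt.continuousWithinAt
  exact ⟨Z, hZ, hpos Z hZ, hmax⟩

theorem exists_posDef_inv_mem_orthogonal {L : AffineSubspace ℝ (SymMat ι)} (hL : id ∈ L) {δ : ℝ}
    (hδ : 0 ≤ δ) (hδ' : δ < 1 / 2) (htrace : ∀ U ∈ L.direction, |⟪U, id⟫_ℝ| ≤ δ * ‖U‖) :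
    ∃ Z ∈ L, Z.mat.PosDef ∧ Z.inv ∈ L.directionᗮ := by
  obtain ⟨ρ, hδρ, hρ1⟩ : ∃ ρ, δ / (1 - δ) < ρ ∧ ρ < 1 :=
    exists_between ((div_lt_one (by linarith)).2 (by linarith))
  have hρ : 0 ≤ ρ := (div_nonneg hδ (by linarith)).trans hδρ.le
  obtain ⟨Z, hZ, hpos, hmax⟩ := exists_isMaxOn_log_det hL hρ hρ1
  have hascent : 0 ≤ ⟪Z.inv, Z - id⟫_ℝ :=
    inner_gradient_sub_nonneg_of_isMaxOn (L.convex.inter (convex_closedBall id ρ))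
      (hasGradientAt_log_det hpos) hmax hZ ⟨hL, Metric.mem_closedBall_self hρ⟩
  have hnorm : ‖Z - id‖ < ρ :=
    (norm_sub_id_le hδ (by linarith) hpos hascent ((le_abs_self _).trans
      (htrace _ (AffineSubspace.vsub_mem_direction hZ.1 hL)))).trans_lt hδρ
  have hball : Metric.closedBall id ρ ∈ 𝓝 Z := by
    refine mem_of_superset (Metric.isOpen_ball.mem_nhds ?_) Metric.ball_subset_closedBall
    exact mem_ball_iff_norm.2 hnorm
  have hlocal : IsLocalMaxOn (fun W : SymMat ι => Real.log W.mat.det) L Z := by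
    filter_upwards [self_mem_nhdsWithin, mem_nhdsWithin_of_mem_nhds hball] with W hWL hW
      using hmax ⟨hWL, hW⟩
  exact ⟨Z, hZ.1, hpos,
    gradient_mem_orthogonal_of_isLocalExtrOn (hasGradientAt_log_det hpos) (.inr hlocal) hZ.1⟩

end SymMat

section Barrier

variable {n k : ℕ}

/-- The family all of whose blocks are identity matrices. The point `Y0 n k` is a multiple of it. -/
def idBlocks (n k : ℕ) : SymBlocks n k :=
  WithLp.toLp 2 fun _ => SymMat.id

theorem Y0_eq_smul_idBlocks : Y0 n k = ((n - 1).choose (k - 1) : ℝ)⁻¹ • idBlocks n k :=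
  rfl

theorem eventually_posDef_blocks {Y : SymBlocks n k} (hY : ∀ J, (Y J).mat.PosDef) :
    ∀ᶠ W in 𝓝 Y, ∀ J, (W J).mat.PosDef :=
  eventually_all.2 fun J => (PiLp.hasFDerivAt_apply (𝕜 := ℝ) 2 Y J).continuousAt.eventually
    (SymMat.eventually_posDef (hY J))

theorem hasGradientAt_fFW {Y : SymBlocks n k} (hY : ∀ J, (Y J).mat.PosDef) :
    HasGradientAt (fFW n k) (WithLp.toLp 2 fun J => -(Y J).inv) Y := by
  rw [hasGradientAt_iff_hasFDerivAt]
  have hblock (J : Blocks n k) : HasFDerivAt (fun W : SymBlocks n k => Real.log (W J).mat.det)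
      ((InnerProductSpace.toDual ℝ (SymMat (Fin k)) (Y J).inv) ∘L
        (PiLp.proj 2 (fun _ : Blocks n k => SymMat (Fin k)) J)) Y :=
    HasFDerivAt.comp (g := fun W : SymMat (Fin k) => Real.log W.mat.det) Y
      (SymMat.hasGradientAt_log_det (hY J)).hasFDerivAt (PiLp.hasFDerivAt_apply 2 Y J)
  refine (HasFDerivAt.fun_sum fun J _ => hblock J).neg.congr_fderiv ?_
  ext1 U
  simp [PiLp.inner_apply]

theorem posDef_smul_idBlocks {a : ℝ} (ha : 0 < a) (J : Blocks n k) :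
    ((a • idBlocks n k) J).mat.PosDef :=
  SymMat.posDef_smul_id ha

theorem gradient_fFW_smul_idBlocks {a : ℝ} (ha : 0 < a) :
    gradient (fFW n k) (a • idBlocks n k) = -a⁻¹ • idBlocks n k := by
  rw [(hasGradientAt_fFW (posDef_smul_idBlocks ha)).gradient]
  ext1 J
  change -(a • SymMat.id).inv = -a⁻¹ • SymMat.id
  rw [SymMat.inv_smul_id ha.ne', neg_smul]

theorem hasFDerivAt_gradient_fFW_smul_idBlocks {a : ℝ} (ha : 0 < a) :
    HasFDerivAt (gradient (fFW n k)) ((a⁻¹ ^ 2) • ContinuousLinearMap.id ℝ (SymBlocks n k))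
      (a • idBlocks n k) := by
  have hgrad : gradient (fFW n k) =ᶠ[𝓝 (a • idBlocks n k)]
      fun Y => WithLp.toLp 2 fun J => -(Y J).inv := by
    filter_upwards [eventually_posDef_blocks (posDef_smul_idBlocks ha)] with Y hY
      using (hasGradientAt_fFW hY).gradient
  refine HasFDerivAt.congr_of_eventuallyEq ?_ hgrad
  rw [← hasFDerivWithinAt_univ, hasFDerivWithinAt_piLp]
  intro J
  rw [hasFDerivWithinAt_univ]
  refine ((SymMat.hasFDerivAt_inv_smul_id ha.ne').comp (a • idBlocks n k)
    (PiLp.hasFDerivAt_apply (𝕜 := ℝ) 2 _ J)).neg.congr_fderiv ?_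
  ext1 U
  simp

theorem newtonDecrement_fFW_smul_idBlocks {a : ℝ} (ha : 0 < a)
    (L : AffineSubspace ℝ (SymBlocks n k)) :
    newtonDecrement (fFW n k) L (a • idBlocks n k) =
      ‖L.direction.starProjection (idBlocks n k)‖ := by
  rw [newtonDecrement_eq_of_hasFDerivAt_gradient (by positivity)
    (hasFDerivAt_gradient_fFW_smul_idBlocks ha), gradient_fFW_smul_idBlocks ha, map_smul,
    norm_smul, norm_neg, Real.norm_of_nonneg (by positivity), Real.sqrt_sq (by positivity),
    inv_mul_cancel_left₀ (inv_ne_zero ha.ne')]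

theorem expand_apply_orderIsoOfFin (J : Blocks n k) (S : Matrix (Fin k) (Fin k) ℝ) (a b : Fin k) :
    expand J S (J.1.orderIsoOfFin J.2 a) (J.1.orderIsoOfFin J.2 b) = S a b := by
  simp [expand, -Finset.coe_orderIsoOfFin_apply]

theorem expand_apply_of_notMem (J : Blocks n k) (S : Matrix (Fin k) (Fin k) ℝ) {i j : Fin n}
    (hij : ¬(i ∈ J.1 ∧ j ∈ J.1)) : expand J S i j = 0 :=
  dif_neg hij

theorem sum_orderIsoOfFin (J : Blocks n k) (g : Fin n → ℝ) :
    ∑ a, g (J.1.orderIsoOfFin J.2 a) = ∑ i ∈ J.1, g i :=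
  ((J.1.orderIsoOfFin J.2).toEquiv.sum_comp fun i : J.1 => g i).trans (Finset.sum_coe_sort J.1 g)

theorem trace_expand (J : Blocks n k) (S : Matrix (Fin k) (Fin k) ℝ) :
    (expand J S).trace = S.trace := by
  calc (expand J S).trace = ∑ i ∈ J.1, expand J S i i :=
        (Finset.sum_subset (Finset.subset_univ J.1) fun i _ hi =>
          expand_apply_of_notMem J S fun h => hi h.1).symm
    _ = ∑ a, expand J S (J.1.orderIsoOfFin J.2 a) (J.1.orderIsoOfFin J.2 a) :=
        (sum_orderIsoOfFin J fun i => expand J S i i).symm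
    _ = S.trace := Finset.sum_congr rfl fun a _ => expand_apply_orderIsoOfFin J S a a

theorem inner_idBlocks (Y : SymBlocks n k) : ⟪Y, idBlocks n k⟫_ℝ = ⟪Psi n k Y, SymMat.id⟫_ℝ := by
  calc ⟪Y, idBlocks n k⟫_ℝ = ∑ J, ⟪Y J, SymMat.id⟫_ℝ := PiLp.inner_apply _ _
    _ = ∑ J, ⟪expandSym J (Y J), SymMat.id⟫_ℝ := by
        refine Finset.sum_congr rfl fun J _ => ?_
        rw [SymMat.inner_id, SymMat.inner_id]
        exact (trace_expand J _).symm
    _ = ⟪Psi n k Y, SymMat.id⟫_ℝ := (sum_inner _ _ _).symm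

/-- The number of index sets of size `k` that contain both `i` and `j`: the number of blocks that
contribute to the entry `(i, j)` of a value of `Psi n k`. -/
def pairCount (k : ℕ) (i j : Fin n) : ℕ :=
  (Finset.univ.filter fun J : Blocks n k => i ∈ J.1 ∧ j ∈ J.1).card

theorem pairCount_comm (i j : Fin n) : pairCount k i j = pairCount k j i := by
  simp only [pairCount, and_comm]

theorem pairCount_pos (hk : 2 ≤ k) (hkn : k ≤ n) (i j : Fin n) : 0 < pairCount k i j := by
  obtain ⟨J, hJ, -, hJk⟩ := Finset.exists_subsuperset_card_eq (Finset.subset_univ {i, j})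
    (Finset.card_le_two.trans hk) (by simpa using hkn)
  refine Finset.card_pos.2 ⟨⟨J, hJk⟩, Finset.mem_filter.2 ⟨Finset.mem_univ _, hJ ?_, hJ ?_⟩⟩ <;>
    simp

theorem sum_blocks_ite (i j : Fin n) (x : ℝ) :
    (∑ J : Blocks n k, if i ∈ J.1 ∧ j ∈ J.1 then x else 0) = pairCount k i j * x := by
  rw [← Finset.sum_filter, Finset.sum_const, nsmul_eq_mul, pairCount]

theorem sum_blocks_sum_sum (g : Fin n → Fin n → ℝ) :
    ∑ J : Blocks n k, ∑ i ∈ J.1, ∑ j ∈ J.1, g i j = ∑ i, ∑ j, pairCount k i j * g i j := by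
  have hite (J : Blocks n k) : ∑ i ∈ J.1, ∑ j ∈ J.1, g i j =
      ∑ i, ∑ j, if i ∈ J.1 ∧ j ∈ J.1 then g i j else 0 := by
    simp only [ite_and, Finset.sum_ite_mem, Finset.sum_ite_irrel, Finset.sum_const_zero,
      Finset.univ_inter]
  simp only [hite, ← sum_blocks_ite]
  rw [Finset.sum_comm]
  exact Finset.sum_congr rfl fun i _ => Finset.sum_comm

/-- The principal submatrix with rows and columns in `J`. -/
def principal (J : Blocks n k) (Z : SymMat (Fin n)) : SymMat (Fin k) :=
  SymMat.mk (Z.mat.submatrix (fun a => J.1.orderIsoOfFin J.2 a) fun a => J.1.orderIsoOfFin J.2 a)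
    (Z.isSymm.submatrix _)

theorem mat_principal_apply (J : Blocks n k) (Z : SymMat (Fin n)) (a b : Fin k) :
    (principal J Z).mat a b = Z.mat (J.1.orderIsoOfFin J.2 a) (J.1.orderIsoOfFin J.2 b) :=
  rfl

theorem mat_expandSym_principal_apply (J : Blocks n k) (Z : SymMat (Fin n)) (i j : Fin n) :
    (expandSym J (principal J Z)).mat i j = if i ∈ J.1 ∧ j ∈ J.1 then Z.mat i j else 0 := by
  change expand J (principal J Z).mat i j = _
  by_cases hij : i ∈ J.1 ∧ j ∈ J.1 <;> simp [expand, hij, mat_principal_apply]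

theorem norm_principal_sq (J : Blocks n k) (Z : SymMat (Fin n)) :
    ‖principal J Z‖ ^ 2 = ∑ i ∈ J.1, ∑ j ∈ J.1, Z.mat i j ^ 2 := by
  calc ‖principal J Z‖ ^ 2 =
        ∑ a, ∑ b, Z.mat (J.1.orderIsoOfFin J.2 a) (J.1.orderIsoOfFin J.2 b) ^ 2 :=
        (principal J Z).norm_sq_eq_sum
    _ = ∑ a, ∑ j ∈ J.1, Z.mat (J.1.orderIsoOfFin J.2 a) j ^ 2 :=
        Finset.sum_congr rfl fun a _ => sum_orderIsoOfFin J fun j => Z.mat _ j ^ 2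
    _ = ∑ i ∈ J.1, ∑ j ∈ J.1, Z.mat i j ^ 2 :=
        sum_orderIsoOfFin J fun i => ∑ j ∈ J.1, Z.mat i j ^ 2

/-- The matrix with the entries `Z i j / pairCount k i j`: the share of each entry of `Z` that
goes to each of the blocks that contain its position. -/
def divPairCount (k : ℕ) (Z : SymMat (Fin n)) : SymMat (Fin n) :=
  SymMat.mk (Matrix.of fun i j => Z.mat i j / pairCount k i j) (by
    ext i j
    simp only [Matrix.transpose_apply, Matrix.of_apply]
    rw [pairCount_comm, Z.isSymm.apply])

/-- A right inverse of `Psi n k` for `2 ≤ k ≤ n`, which distributes every entry of `Z` evenly over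
the blocks that contain its position. -/
def spread (k : ℕ) (Z : SymMat (Fin n)) : SymBlocks n k :=
  WithLp.toLp 2 fun J => principal J (divPairCount k Z)

theorem Psi_spread (hk : 2 ≤ k) (hkn : k ≤ n) (Z : SymMat (Fin n)) :
    Psi n k (spread k Z) = Z := by
  apply SymMat.mat_injective
  ext i j
  have hcount : (pairCount k i j : ℝ) ≠ 0 := mod_cast (pairCount_pos hk hkn i j).ne'
  change (SymMat.mat (∑ J, expandSym J (principal J (divPairCount k Z)))) i j = Z.mat i j
  simp only [map_sum, Matrix.sum_apply, mat_expandSym_principal_apply]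
  rw [sum_blocks_ite]
  exact mul_div_cancel₀ _ hcount

theorem norm_spread_le (hk : 2 ≤ k) (hkn : k ≤ n) (Z : SymMat (Fin n)) :
    ‖spread k Z‖ ≤ ‖Z‖ := by
  refine (sq_le_sq₀ (norm_nonneg _) (norm_nonneg _)).1 ?_
  calc ‖spread k Z‖ ^ 2 = ∑ J : Blocks n k, ‖principal J (divPairCount k Z)‖ ^ 2 :=
        PiLp.norm_sq_eq_of_L2 _ _
    _ = ∑ i, ∑ j, pairCount k i j * (Z.mat i j / pairCount k i j) ^ 2 := by
        simp only [norm_principal_sq]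
        exact sum_blocks_sum_sum fun i j => (Z.mat i j / pairCount k i j) ^ 2
    _ ≤ ∑ i, ∑ j, Z.mat i j ^ 2 := by
        refine Finset.sum_le_sum fun i _ => Finset.sum_le_sum fun j _ => ?_
        have hcount : (1 : ℝ) ≤ pairCount k i j := mod_cast pairCount_pos hk hkn i j
        calc pairCount k i j * (Z.mat i j / pairCount k i j) ^ 2
            = Z.mat i j ^ 2 / pairCount k i j := by field_simp
          _ ≤ Z.mat i j ^ 2 := div_le_self (sq_nonneg _) hcount
    _ = ‖Z‖ ^ 2 := Z.norm_sq_eq_sum.symm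

theorem spread_mem_direction (hk : 2 ≤ k) (hkn : k ≤ n) {F : Type} [AddCommGroup F] [Module ℝ F]
    {T : SymMat (Fin n) →ₗ[ℝ] F} {c : F} {W U : SymMat (Fin n)} (hW : W ∈ solutionSet T c)
    (hU : U ∈ (solutionSet T c).direction) :
    spread k U ∈ (solutionSet (T ∘ₗ Psi n k) c).direction := by
  have hspread : spread k W ∈ solutionSet (T ∘ₗ Psi n k) c := by
    rw [mem_solutionSet, LinearMap.comp_apply, Psi_spread hk hkn]
    exact hW
  rw [direction_solutionSet hW, LinearMap.mem_ker] at hU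
  rw [direction_solutionSet hspread, LinearMap.mem_ker, LinearMap.comp_apply, Psi_spread hk hkn,
    hU]

theorem abs_inner_id_le_newtonDecrement_fFW (hk : 2 ≤ k) (hkn : k ≤ n) {F : Type}
    [AddCommGroup F] [Module ℝ F] {T : SymMat (Fin n) →ₗ[ℝ] F} {c : F} {W U : SymMat (Fin n)}
    (hW : W ∈ solutionSet T c) (hU : U ∈ (solutionSet T c).direction) :
    |⟪U, SymMat.id⟫_ℝ| ≤
      newtonDecrement (fFW n k) (solutionSet (T ∘ₗ Psi n k) c) (Y0 n k) * ‖U‖ := by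
  have hchoose : (0 : ℝ) < (n - 1).choose (k - 1) :=
    mod_cast Nat.choose_pos (Nat.sub_le_sub_right hkn 1)
  rw [Y0_eq_smul_idBlocks, newtonDecrement_fFW_smul_idBlocks (inv_pos.2 hchoose)]
  set P := (solutionSet (T ∘ₗ Psi n k) c).direction.starProjection (idBlocks n k)
  calc |⟪U, SymMat.id⟫_ℝ| = |⟪spread k U, idBlocks n k⟫_ℝ| := by
        rw [inner_idBlocks, Psi_spread hk hkn]
    _ ≤ ‖P‖ * ‖spread k U‖ :=
        abs_inner_le_norm_starProjection_mul_norm (spread_mem_direction hk hkn hW hU) _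
    _ ≤ ‖P‖ * ‖U‖ := by gcongr; exact norm_spread_le hk hkn U

end Barrier

section SDP

variable {n m : ℕ} {A : Fin (m + 1) → SymMat (Fin n)} {b : Fin m → ℝ} {X Z : SymMat (Fin n)}
  {v η δ : ℝ}

open scoped MatrixOrder in
theorem inner_rescale_id (hX : X.mat.PosSemidef) (B : SymMat (Fin n)) :
    ⟪rescale X B, SymMat.id⟫_ℝ = ⟪B, X⟫_ℝ := by
  calc ⟪rescale X B, SymMat.id⟫_ℝ = (CFC.sqrt X.mat * B.mat * CFC.sqrt X.mat).trace :=
        SymMat.inner_id _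
    _ = (CFC.sqrt X.mat * CFC.sqrt X.mat * B.mat).trace := by
        rw [Matrix.trace_mul_comm, Matrix.mul_assoc]
    _ = ⟪B, X⟫_ℝ := by
        rw [CFC.sqrt_mul_sqrt_self X.mat (Matrix.nonneg_iff_posSemidef.2 hX),
          Matrix.trace_mul_comm, SymMat.inner_def]

theorem traceOp_eq_iff {κ : Type} {B : κ → SymMat (Fin n)} {c : κ → ℝ} :
    traceOp B Z = c ↔ ∀ i, ⟪B i, Z⟫_ℝ = c i :=
  funext_iff

/-- The points of `L_ℓ` with objective value `v`. The space `L^Ψ_ℓ(v)` is the preimage of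
`levelSlice A b X v` under `Ψ`. -/
def levelSlice (A : Fin (m + 1) → SymMat (Fin n)) (b : Fin m → ℝ) (X : SymMat (Fin n)) (v : ℝ) :
    AffineSubspace ℝ (SymMat (Fin n)) :=
  solutionSet (traceOp fun i => rescale X (A i)) (Fin.cons v b)

theorem mem_levelSlice :
    Z ∈ levelSlice A b X v ↔ Z ∈ Lell A b X ∧ ⟪rescale X (A 0), Z⟫_ℝ = v := by
  simp only [levelSlice, Lell, mem_solutionSet, traceOp_eq_iff, Fin.forall_fin_succ,
    Fin.cons_zero, Fin.cons_succ]
  exact and_comm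

theorem direction_levelSlice (hZ : Z ∈ levelSlice A b X v) :
    (levelSlice A b X v).direction =
      (Lell A b X).direction ⊓ (ℝ ∙ rescale X (A 0))ᗮ := by
  ext U
  rw [levelSlice, direction_solutionSet hZ, Lell, direction_solutionSet (mem_levelSlice.1 hZ).1,
    Submodule.mem_inf, Submodule.mem_orthogonal_singleton_iff_inner_right]
  simp only [LinearMap.mem_ker, traceOp_eq_iff, Fin.forall_fin_succ, Pi.zero_apply]
  exact and_comm

theorem id_mem_levelSlice (hX : X.mat.PosSemidef) (hfeas : ∀ i : Fin m, ⟪A i.succ, X⟫_ℝ = b i)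
    (hv : ⟪A 0, X⟫_ℝ = v) : SymMat.id ∈ levelSlice A b X v := by
  simp only [mem_levelSlice, Lell, mem_solutionSet, traceOp_eq_iff, inner_rescale_id hX]
  exact ⟨hfeas, hv⟩

theorem hasGradientAt_fSDP (A0 X : SymMat (Fin n)) (η : ℝ) (hZ : Z.mat.PosDef) :
    HasGradientAt (fSDP A0 X η) (η • rescale X A0 - Z.inv) Z := by
  rw [hasGradientAt_iff_hasFDerivAt, map_sub, map_smul]
  exact ((InnerProductSpace.toDual ℝ _ (rescale X A0)).hasFDerivAt.const_mul η).sub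
    (SymMat.hasGradientAt_log_det hZ).hasFDerivAt

theorem hasFDerivAt_gradient_fSDP_id (A0 X : SymMat (Fin n)) (η : ℝ) :
    HasFDerivAt (gradient (fSDP A0 X η)) ((1 : ℝ) • ContinuousLinearMap.id ℝ (SymMat (Fin n)))
      SymMat.id := by
  have hgrad : gradient (fSDP A0 X η) =ᶠ[𝓝 SymMat.id] fun Z => η • rescale X A0 - Z.inv := by
    filter_upwards [SymMat.eventually_posDef Matrix.PosDef.one] with Z hZ
      using (hasGradientAt_fSDP A0 X η hZ).gradient
  have hinv := SymMat.hasFDerivAt_inv_smul_id (ι := Fin n) one_ne_zero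
  rw [one_smul] at hinv
  refine ((hinv.const_sub (η • rescale X A0)).congr_fderiv ?_).congr_of_eventuallyEq hgrad
  simp

theorem newtonDecrement_fSDP_id (A0 X : SymMat (Fin n)) (η : ℝ)
    (L : AffineSubspace ℝ (SymMat (Fin n))) :
    newtonDecrement (fSDP A0 X η) L SymMat.id =
      ‖L.direction.starProjection (η • rescale X A0 - SymMat.id)‖ := by
  rw [newtonDecrement_eq_of_hasFDerivAt_gradient one_pos (hasFDerivAt_gradient_fSDP_id A0 X η),
    (hasGradientAt_fSDP A0 X η Matrix.PosDef.one).gradient, SymMat.inv_id, Real.sqrt_one, inv_one,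
    one_mul]

theorem isCentralParameter_iff :
    IsCentralParameter A b X v η ↔ ∃ Z ∈ levelSlice A b X v, Z.mat.PosDef ∧
      η • rescale X (A 0) - Z.inv ∈ (Lell A b X).directionᗮ := by
  constructor
  · rintro ⟨Z, hZL, hpos, hZv, hmin⟩
    refine ⟨Z, mem_levelSlice.2 ⟨hZL, hZv⟩, hpos,
      gradient_mem_orthogonal_of_isLocalExtrOn (hasGradientAt_fSDP _ _ _ hpos) (.inl ?_) hZL⟩
    filter_upwards [self_mem_nhdsWithin, mem_nhdsWithin_of_mem_nhds (SymMat.eventually_posDef hpos)]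
      with W hWL hW using hmin W hWL hW
  · rintro ⟨Z, hZ, hpos, horth⟩
    obtain ⟨hZL, hZv⟩ := mem_levelSlice.1 hZ
    refine ⟨Z, hZL, hpos, hZv, fun W hWL hW => ?_⟩
    have hstationary : ⟪η • rescale X (A 0) - Z.inv, W - Z⟫_ℝ = 0 :=
      Submodule.inner_left_of_mem_orthogonal (AffineSubspace.vsub_mem_direction hWL hZL) horth
    have hconcave := SymMat.log_det_le_add_inner hW hpos
    rw [inner_sub_left, real_inner_smul_left, inner_sub_right] at hstationary
    simp only [fSDP]
    linarith

theorem exists_isCentralParameter (hid : SymMat.id ∈ levelSlice A b X v) (hδ : 0 ≤ δ)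
    (hδ' : δ < 1 / 2)
    (htrace : ∀ U ∈ (levelSlice A b X v).direction, |⟪U, SymMat.id⟫_ℝ| ≤ δ * ‖U‖) :
    ∃ η, IsCentralParameter A b X v η := by
  obtain ⟨Z, hZ, hpos, horth⟩ := SymMat.exists_posDef_inv_mem_orthogonal hid hδ hδ' htrace
  rw [direction_levelSlice hid] at horth
  obtain ⟨η, hη⟩ := exists_smul_sub_mem_orthogonal horth
  exact ⟨η, isCentralParameter_iff.2 ⟨Z, hZ, hpos, hη⟩⟩

theorem norm_starProjection_sub_id_le {V : Submodule ℝ (SymMat (Fin n))} {W : SymMat (Fin n)}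
    (hδ : 0 ≤ δ) (hδ' : δ < 1 / 2) (hpos : Z.mat.PosDef) (horth : W - Z.inv ∈ Vᗮ)
    (hZ : 0 ≤ ⟪Z.inv, Z - SymMat.id⟫_ℝ)
    (htrace : ⟪Z - SymMat.id, SymMat.id⟫_ℝ ≤ δ * ‖Z - SymMat.id‖) :
    ‖V.starProjection (W - SymMat.id)‖ ≤ δ / (1 - 2 * δ) := by
  have hproj : V.starProjection (W - SymMat.id) = V.starProjection (Z.inv - SymMat.id) := by
    rw [← sub_eq_zero, ← map_sub, sub_sub_sub_cancel_right]
    exact V.starProjection_apply_eq_zero_iff.2 horth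
  have hr : ‖Z - SymMat.id‖ ≤ δ / (1 - δ) := SymMat.norm_sub_id_le hδ (by linarith) hpos hZ htrace
  have hr1 : δ / (1 - δ) < 1 := (div_lt_one (by linarith)).2 (by linarith)
  calc ‖V.starProjection (W - SymMat.id)‖ ≤ ‖Z.inv - SymMat.id‖ := by
        rw [hproj]
        exact V.norm_starProjection_apply_le _
    _ ≤ ‖Z - SymMat.id‖ / (1 - ‖Z - SymMat.id‖) := SymMat.norm_inv_sub_id_le (hr.trans_lt hr1)
    _ ≤ δ / (1 - δ) / (1 - δ / (1 - δ)) := by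
        have : 0 < 1 - δ / (1 - δ) := sub_pos.2 hr1
        have : 0 ≤ δ / (1 - δ) := (norm_nonneg _).trans hr
        gcongr
    _ = δ / (1 - 2 * δ) := by
        have hne : 1 - δ ≠ 0 := by linarith
        rw [one_sub_div hne, div_div_div_cancel_right₀ hne, sub_sub, ← two_mul]

theorem IsCentralParameter.newtonDecrement_fSDP_id_le (hη : IsCentralParameter A b X v η)
    (hid : SymMat.id ∈ levelSlice A b X v) (hδ : 0 ≤ δ) (hδ' : δ < 1 / 2)
    (htrace : ∀ U ∈ (levelSlice A b X v).direction, |⟪U, SymMat.id⟫_ℝ| ≤ δ * ‖U‖) :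
    newtonDecrement (fSDP (A 0) X η) (Lell A b X) SymMat.id ≤ δ / (1 - 2 * δ) := by
  obtain ⟨Z, hZ, hpos, horth⟩ := isCentralParameter_iff.1 hη
  have hdir : Z - SymMat.id ∈ (levelSlice A b X v).direction :=
    AffineSubspace.vsub_mem_direction hZ hid
  have hZinv : ⟪Z.inv, Z - SymMat.id⟫_ℝ = 0 := by
    obtain ⟨hL, hA0⟩ := Submodule.mem_inf.1 (direction_levelSlice hid ▸ hdir)
    have h := Submodule.inner_left_of_mem_orthogonal hL horth
    rwa [inner_sub_left, real_inner_smul_left,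
      Submodule.mem_orthogonal_singleton_iff_inner_right.1 hA0, mul_zero, zero_sub,
      neg_eq_zero] at h
  rw [newtonDecrement_fSDP_id]
  exact norm_starProjection_sub_id_le hδ hδ' hpos horth hZinv.ge
    ((le_abs_self _).trans (htrace _ hdir))

end SDP

end FactorWidth

end

theorem mainTheorem3_general {n k m : ℕ} (hk : 2 ≤ k) (hkn : k ≤ n)
    (A : Fin (m + 1) → SymMat (Fin n)) (b : Fin m → ℝ)
    (X : SymMat (Fin n)) (hX : X.mat.PosSemidef)
    (hfeas : ∀ i : Fin m, inner ℝ (A i.succ) X = b i)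
    (v : ℝ) (hv : inner ℝ (A 0) X = v) {δ : ℝ} (hδ : δ < 1 / 2)
    (hdec : newtonDecrement (fFW n k) (LPsi k A b X v) (Y0 n k) ≤ δ) :
    (∃ η : ℝ, IsCentralParameter A b X v η) ∧
      ∀ η : ℝ, IsCentralParameter A b X v η →
        newtonDecrement (fSDP (A 0) X η) (Lell A b X) SymMat.id ≤ δ / (1 - 2 * δ) := by
  have hδ0 : 0 ≤ δ := (newtonDecrement_nonneg _ _ _).trans hdec
  have hid : SymMat.id ∈ levelSlice A b X v := id_mem_levelSlice hX hfeas hv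
  have htrace : ∀ U ∈ (levelSlice A b X v).direction, |inner ℝ U SymMat.id| ≤ δ * ‖U‖ :=
    fun U hU => (abs_inner_id_le_newtonDecrement_fFW hk hkn hid hU).trans
      (mul_le_mul_of_nonneg_right hdec (norm_nonneg U))
  exact ⟨exists_isCentralParameter hid hδ0 hδ htrace,
    fun η hη => hη.newtonDecrement_fSDP_id_le hid hδ0 hδ htrace⟩

theorem mainTheorem3 (n k m : ℕ) (hn : 0 < n) (hk : 2 ≤ k) (hkn : k ∣ n)
    (A : Fin (m + 1) → SymMat (Fin n)) (b : Fin m → ℝ)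
    (X : SymMat (Fin n)) (hX : X.mat.PosSemidef)
    (hfeas : ∀ i : Fin m, inner ℝ (A i.succ) X = b i)
    (v : ℝ) (hv : inner ℝ (A 0) X = v)
    (hdec : newtonDecrement (fFW n k) (LPsi k A b X v) (Y0 n k) ≤ 1 / 14) :
    (∃ η : ℝ, IsCentralParameter A b X v η) ∧
      ∀ η : ℝ, IsCentralParameter A b X v η →
        newtonDecrement (fSDP (A 0) X η) (Lell A b X) SymMat.id ≤ 1 / 9 :=
  (mainTheorem3_general hk (Nat.le_of_dvd hn hkn) A b X hX hfeas v hv (by norm_num) hdec).imp_right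
    fun hbound η hη => (hbound η hη).trans (by norm_num)
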